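/- Let $n\ge 1$ and let $M_0\subset\mathbb R^{n+1}$. There is a constant $c_3>0$ depending only on $n$ and $M_0$, and for every $T_0>0$ there is a constant $G>0$ depending only on $n$, $M_0$ and $T_0$, such that the following holds. Let $M$ be a non-empty closed smooth $n$-manifold, let $T_c>T_0$, and let $F:M\times[0,T_c)\to\mathbb R^{n+1}$ be a smooth family of immersions with a continuous unit normal field $\nu$, moving by mean curvature, $$\frac{\partial F}{\partial t}(p,t)=-H(p,t)\,\nu(p,t),$$ where $H=g^{ij}h_{ij}$, $g_{ij}=\langle\partial_iF,\partial_jF\rangle$ and $h_{ij}=-\langle\partial_i\partial_jF,\nu\rangle$ (so that $H=n/r$ on a round sphere of radius $r$ with its outer normal). Suppose that $F(M,0)=M_0$ and that the initial hypersurface is star-shaped about the origin with outer normal $\nu(\cdot,0)$, i.e. $\langle F(p,0),\nu(p,0)\rangle>0$ for all $p\in M$. Put $$f_0=\max_{p\in M}\langle F(p,0),\nu(p,0)\rangle^{-1},\qquad T=\min\Big\{\frac1{G f_0^4},\,T_0\Big\}.$$ Then $0<T\le T_0$, and for all $t\in[0,T]$ and $p\in M$ $$\langle F(p,t),\nu(p,t)\rangle>0\quad\text{and}\quad\langle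 F(p,t),\nu(p,t)\rangle^{-1}\le 2c_3f_0 .$$ -/

import Mathlib

open Set
open scoped Manifold ContDiff

noncomputable section

namespace StarMCF

/-- The ambient Euclidean space `ℝ^{n+1}`. -/
abbrev Amb (n : ℕ) : Type := EuclideanSpace ℝ (Fin (n + 1))

section Hypersurface

variable {n : ℕ} {M : Type*} [TopologicalSpace M] [ChartedSpace (EuclideanSpace ℝ (Fin n)) M]

/-- The parametrization `X : M → ℝ^{n+1}` read in the chart at `p`. -/
def localRep (X : M → Amb n) (p : M) : EuclideanSpace ℝ (Fin n) → Amb n :=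
  fun y => X ((extChartAt (𝓡 n) p).symm y)

/-- The coordinate derivative `∂ᵢ φ` of a map `φ` on `ℝⁿ`. -/
def partialD (i : Fin n) (φ : EuclideanSpace ℝ (Fin n) → Amb n) :
    EuclideanSpace ℝ (Fin n) → Amb n :=
  fun y => fderiv ℝ φ y (EuclideanSpace.single i 1)

/-- First fundamental form `g_{ij} = ⟨∂ᵢX, ∂ⱼX⟩` at `p`, in the chart at `p`. -/
def firstForm (X : M → Amb n) (p : M) : Matrix (Fin n) (Fin n) ℝ :=
  Matrix.of fun i j =>
    inner ℝ (partialD i (localRep X p) (extChartAt (𝓡 n) p p))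
      (partialD j (localRep X p) (extChartAt (𝓡 n) p p))

/-- Second fundamental form `h_{ij} = -⟨∂ᵢ∂ⱼX, N⟩` at `p` with respect to the unit normal `N`
at `p`, in the chart at `p`. The sign makes round spheres positive for the outer normal. -/
def secondForm (X : M → Amb n) (N : Amb n) (p : M) : Matrix (Fin n) (Fin n) ℝ :=
  Matrix.of fun i j =>
    -inner ℝ (partialD i (partialD j (localRep X p)) (extChartAt (𝓡 n) p p)) N

/-- Mean curvature `H = g^{ij} h_{ij}` at `p` with respect to the unit normal `N` at `p`
(so `H = n / r` on the round sphere of radius `r` with its outer normal). -/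
def meanCurvature (X : M → Amb n) (N : Amb n) (p : M) : ℝ :=
  ((firstForm X p)⁻¹ * secondForm X N p).trace

/-- `F : M × [0, Tc) → ℝ^{n+1}` is a smooth family of immersed hypersurfaces with continuous
unit normal field `ν`, moving by mean curvature: `∂F/∂t = -H ν` (one-sided at `t = 0`). -/
structure IsMeanCurvatureFlow (Tc : ℝ) (F ν : M → ℝ → Amb n) : Prop where
  smooth : ContMDiffOn ((𝓡 n).prod 𝓘(ℝ, ℝ)) 𝓘(ℝ, Amb n) ∞
    (fun q : M × ℝ => F q.1 q.2) (univ ×ˢ Ico 0 Tc)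
  immersion : ∀ t ∈ Ico 0 Tc, ∀ p : M,
    Function.Injective (mfderiv (𝓡 n) 𝓘(ℝ, Amb n) (fun q => F q t) p)
  normal_continuous : ContinuousOn (fun q : M × ℝ => ν q.1 q.2) (univ ×ˢ Ico 0 Tc)
  normal_unit : ∀ t ∈ Ico 0 Tc, ∀ p : M, ‖ν p t‖ = 1
  normal_orthogonal : ∀ t ∈ Ico 0 Tc, ∀ p : M, ∀ v : TangentSpace (𝓡 n) p,
    inner ℝ (E := Amb n) (mfderiv (𝓡 n) 𝓘(ℝ, Amb n) (fun q => F q t) p v) (ν p t) = 0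
  evolution : ∀ t ∈ Ico 0 Tc, ∀ p : M,
    HasDerivWithinAt (F p) (-(meanCurvature (fun q => F q t) (ν p t) p) • ν p t) (Ico 0 Tc) t

/-- A hypersurface `X` with unit normal field `N` is star-shaped about the origin, with `N` its
outer normal, if the support function `⟨X, N⟩` is positive everywhere. -/
def IsStarShaped (X N : M → Amb n) : Prop :=
  ∀ p, 0 < inner ℝ (X p) (N p)

end Hypersurface

end StarMCF

end

/-! The proof is a maximum principle for the support function `u = ⟨F, ν⟩`. Along the flow `∂ₜν =
∇H`, so `∂ₜu = -H + ⟨F, ∇H⟩`. At a spatial critical point `Δu = H + ⟨F, ∇H⟩ - |A|² u`. At a positive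
spatial minimum `Δu ≥ 0`, and with `H² ≤ n |A|²` `∂ₜu ≥ -2H + u H² / n = (n - uH)² / (n u) - n / u ≥
-n / u`. No curvature bound is needed.

Initially `u ≥ 1 / f₀`. As long as `u ≥ 1 / (2 f₀)` its minimum falls at rate at most `2 n f₀`, so
`u` cannot touch a barrier that falls at rate `4 n f₀` and stays above `1 / (2 f₀)`
(`barrier_lt_support`). The resulting time scale is `1 / (16 n f₀²)`. Since `M₀` lies in a ball of
radius `R`, also `R f₀ ≥ 1`, which turns this scale into the required `1 / (G f₀⁴)`.

The geometric core is `sum_dirD_dirD_support` and `support_deriv_ge_of_isLocalMin`, both in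
coordinates whose metric is the identity at one point. Two gaps separate them from the flow on `M`.
The normal is only assumed continuous; `contDiffAt_normal` makes it smooth. The mean curvature is
defined with a different chart at each point, whereas `∇H` needs one parametrization;
`meanCurvature_eq_of_param` supplies the invariance. -/

noncomputable section

namespace StarMCF

open Filter Topology

/-! ### Directional derivatives and the second-derivative test -/

section DirectionalDerivative

variable {E G : Type*} [NormedAddCommGroup E] [NormedSpace ℝ E]
  [NormedAddCommGroup G] [NormedSpace ℝ G]

/-- The derivative of `f` in the constant direction `v`. -/
def dirD (v : E) (f : E → G) : E → G := fun z => fderiv ℝ f z v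

theorem dirD_const (v : E) (c : G) : dirD v (fun _ : E => c) = fun _ => 0 := by
  funext z
  simp [dirD]

theorem contDiffAt_dirD {m k : WithTop ℕ∞} {f : E → G} {z : E} (v : E)
    (hf : ContDiffAt ℝ k f z) (hm : m + 1 ≤ k) : ContDiffAt ℝ m (dirD v f) z :=
  (hf.fderiv_right hm).clm_apply contDiffAt_const

theorem dirD_congr {f g : E → G} {z : E} (v : E) (h : f =ᶠ[𝓝 z] g) :
    dirD v f z = dirD v g z := by
  simp only [dirD, h.fderiv_eq]

theorem dirD_eventuallyEq {f g : E → G} {z : E} (v : E) (h : f =ᶠ[𝓝 z] g) :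
    dirD v f =ᶠ[𝓝 z] dirD v g := by
  filter_upwards [h.fderiv (𝕜 := ℝ)] with y hy
  simp only [dirD, hy]

theorem dirD_dirD {f : E → G} {z : E} (v w : E) (hf : ContDiffAt ℝ 2 f z) :
    dirD v (dirD w f) z = fderiv ℝ (fderiv ℝ f) z v w := by
  have h1 : DifferentiableAt ℝ (fderiv ℝ f) z :=
    (hf.fderiv_right (m := 1) (by norm_num)).differentiableAt (by norm_num)
  unfold dirD
  rw [fderiv_clm_apply h1 (differentiableAt_const w)]
  simp

theorem dirD_comm {f : E → G} {z : E} (v w : E) (hf : ContDiffAt ℝ 2 f z) :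
    dirD v (dirD w f) z = dirD w (dirD v f) z := by
  rw [dirD_dirD v w hf, dirD_dirD w v hf]
  exact (hf.isSymmSndFDerivAt (by simp)).eq v w

theorem eventually_contDiffAt {k : ℕ} {f : E → G} {z : E} (hf : ContDiffAt ℝ k f z) :
    ∀ᶠ y in 𝓝 z, ContDiffAt ℝ k f y :=
  hf.eventually (by simp)

theorem dirD_slice {f : E × ℝ → G} {z : E} {t : ℝ} (w : E) (hf : DifferentiableAt ℝ f (z, t)) :
    dirD w (fun y => f (y, t)) z = dirD (w, (0 : ℝ)) f (z, t) := by
  have h := hf.hasFDerivAt.comp z (hasFDerivAt_prodMk_left (𝕜 := ℝ) z t)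
  have h2 : fderiv ℝ (fun y => f (y, t)) z
      = (fderiv ℝ f (z, t)).comp (ContinuousLinearMap.inl ℝ E ℝ) := h.fderiv
  simp [dirD, h2]

theorem hasDerivAt_slice {f : E × ℝ → G} {z : E} {t : ℝ} (hf : DifferentiableAt ℝ f (z, t)) :
    HasDerivAt (fun s => f (z, s)) (dirD ((0 : E), (1 : ℝ)) f (z, t)) t := by
  have h := hf.hasFDerivAt.comp t (hasFDerivAt_prodMk_right (𝕜 := ℝ) z t)
  have h2 := h.hasDerivAt
  simpa [dirD, Function.comp_def] using h2

/-- The second derivative of a function along a line is nonnegative at a local minimum. -/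
theorem dirD_dirD_nonneg_of_isLocalMin {f : E → ℝ} {z : E} (v : E) (hf : ContDiffAt ℝ 2 f z)
    (hmin : IsLocalMin f z) : 0 ≤ dirD v (dirD v f) z := by
  by_contra! hneg
  set ℓ : ℝ → E := fun s => z + s • v with hℓ
  have hℓ0 : ℓ 0 = z := by simp [hℓ]
  have hℓc : Continuous ℓ := by fun_prop
  have hℓt : Tendsto ℓ (𝓝 0) (𝓝 z) := by simpa [hℓ0] using hℓc.tendsto 0
  have hℓd : ∀ s, HasDerivAt ℓ v s := fun s => by
    simpa [hℓ] using ((hasDerivAt_id s).smul_const v).const_add z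
  have line : ∀ g : E → ℝ, ∀ s, DifferentiableAt ℝ g (ℓ s) →
      HasDerivAt (fun s => g (ℓ s)) (dirD v g (ℓ s)) s := fun g s hg =>
    hg.hasFDerivAt.comp_hasDerivAt s (hℓd s)
  have h1 : deriv (fun s => f (ℓ s)) =ᶠ[𝓝 0] fun s => dirD v f (ℓ s) := by
    filter_upwards [hℓt.eventually (eventually_contDiffAt (k := 2) hf)] with s hs
    exact (line f s (hs.differentiableAt (by norm_num))).deriv
  have hd1 : DifferentiableAt ℝ (dirD v f) z :=
    (contDiffAt_dirD (m := 1) v hf (by norm_num)).differentiableAt (by norm_num)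
  have h2 : deriv (deriv fun s => f (ℓ s)) 0 = dirD v (dirD v f) z := by
    rw [h1.deriv_eq, (line (dirD v f) 0 (by rwa [hℓ0])).deriv, hℓ0]
  have hmin' : IsLocalMin (fun s => f (ℓ s)) 0 := by
    have := hℓt.eventually hmin
    simpa [IsLocalMin, IsMinFilter, hℓ0] using this
  -- A negative second derivative would make the minimum also a local maximum, so `f` would be
  -- constant along the line and the second derivative zero.
  have hmax : IsLocalMax (fun s => f (ℓ s)) 0 := by
    refine isLocalMax_of_deriv_deriv_neg (by rw [h2]; exact hneg) hmin'.deriv_eq_zero ?_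
    exact (line f 0 (by rw [hℓ0]; exact hf.differentiableAt (by norm_num))).continuousAt
  have hconst : (fun s => f (ℓ s)) =ᶠ[𝓝 0] fun _ => f (ℓ 0) := by
    filter_upwards [hmin', hmax] with s h h'
    exact le_antisymm h' h
  have h3 : deriv (deriv fun s => f (ℓ s)) 0 = 0 := by
    rw [hconst.deriv.deriv_eq]
    simp
  rw [h2] at h3
  exact hneg.ne h3

end DirectionalDerivative

/-! ### Product rules for inner products; orthonormal frames -/

section InnerProduct

variable {E A : Type*} [NormedAddCommGroup E] [NormedSpace ℝ E]
  [NormedAddCommGroup A] [InnerProductSpace ℝ A]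

theorem dirD_inner {f g : E → A} {z : E} (v : E) (hf : DifferentiableAt ℝ f z)
    (hg : DifferentiableAt ℝ g z) :
    dirD v (fun y => inner ℝ (f y) (g y)) z
      = inner ℝ (f z) (dirD v g z) + inner ℝ (dirD v f z) (g z) :=
  fderiv_inner_apply ℝ hf hg v

theorem inner_dirD_of_orthogonal {f g : E → A} {z : E} (v : E) (hf : DifferentiableAt ℝ f z)
    (hg : DifferentiableAt ℝ g z) (h0 : ∀ᶠ y in 𝓝 z, (inner ℝ (f y) (g y) : ℝ) = 0) :
    inner ℝ (f z) (dirD v g z) = -inner ℝ (dirD v f z) (g z) := by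
  have h := dirD_congr v (show (fun y => (inner ℝ (f y) (g y) : ℝ)) =ᶠ[𝓝 z] fun _ => 0 from h0)
  rw [dirD_inner v hf hg, dirD_const] at h
  exact eq_neg_of_add_eq_zero_left h

theorem inner_dirD_of_unit {g : E → A} {z : E} (v : E) (hg : DifferentiableAt ℝ g z)
    (h1 : ∀ᶠ y in 𝓝 z, ‖g y‖ = 1) : inner ℝ (g z) (dirD v g z) = 0 := by
  have h0 : (fun y => (inner ℝ (g y) (g y) : ℝ)) =ᶠ[𝓝 z] fun _ => 1 :=
    h1.mono fun y hy => by simp [hy]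
  have h := dirD_congr v h0
  rw [dirD_inner v hg hg, dirD_const, real_inner_comm (g z)] at h
  linarith

theorem dirD_dirD_inner {f g : E → A} {z : E} (v w : E) (hf : ContDiffAt ℝ 2 f z)
    (hg : ContDiffAt ℝ 2 g z) :
    dirD v (dirD w fun y => inner ℝ (f y) (g y)) z
      = inner ℝ (f z) (dirD v (dirD w g) z) + inner ℝ (dirD v f z) (dirD w g z)
        + (inner ℝ (dirD w f z) (dirD v g z) + inner ℝ (dirD v (dirD w f) z) (g z)) := by
  have h : dirD w (fun y => inner ℝ (f y) (g y)) =ᶠ[𝓝 z]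
      fun y => inner ℝ (f y) (dirD w g y) + inner ℝ (dirD w f y) (g y) := by
    filter_upwards [eventually_contDiffAt (k := 2) hf, eventually_contDiffAt (k := 2) hg]
      with y hfy hgy
    exact dirD_inner w (hfy.differentiableAt (by norm_num)) (hgy.differentiableAt (by norm_num))
  have hf' := hf.differentiableAt (by norm_num)
  have hg' := hg.differentiableAt (by norm_num)
  have hdf : DifferentiableAt ℝ (dirD w f) z :=
    (contDiffAt_dirD (m := 1) w hf (by norm_num)).differentiableAt (by norm_num)
  have hdg : DifferentiableAt ℝ (dirD w g) z :=
    (contDiffAt_dirD (m := 1) w hg (by norm_num)).differentiableAt (by norm_num)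
  rw [dirD_congr v h, ← dirD_inner v hf' hdg, ← dirD_inner v hdf hg']
  exact congrArg (fun L : E →L[ℝ] ℝ => L v)
    (fderiv_fun_add (hf'.inner ℝ hdg) (hdf.inner ℝ hg'))

end InnerProduct

/-- A unit vector and `n` orthonormal vectors orthogonal to it span `ℝ^{n+1}`. -/
theorem eq_normal_add_tangential {n : ℕ} {b : Fin n → Amb n} {N : Amb n} (hb : Orthonormal ℝ b)
    (hN : ‖N‖ = 1) (hbN : ∀ i, inner ℝ (b i) N = 0) (v : Amb n) :
    v = (inner ℝ N v : ℝ) • N + ∑ i, (inner ℝ (b i) v : ℝ) • b i := by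
  have ho : Orthonormal ℝ (Fin.cons N b : Fin (n + 1) → Amb n) := by
    rw [orthonormal_iff_ite] at hb ⊢
    intro i j
    refine Fin.cases ?_ (fun i => ?_) i <;> refine Fin.cases ?_ (fun j => ?_) j
    · simp [hN]
    · simpa [(Fin.succ_ne_zero j).symm] using (real_inner_comm _ _).trans (hbN j)
    · simp [hbN]
    · simp [hb]
  have hspan : ⊤ ≤ Submodule.span ℝ (Set.range (Fin.cons N b : Fin (n + 1) → Amb n)) := by
    rw [ho.linearIndependent.span_eq_top_of_card_eq_finrank' (by simp)]
  have h := (OrthonormalBasis.mk ho hspan).sum_repr' v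
  rw [Fin.sum_univ_succ] at h
  simpa using h.symm

/-! ### Differentiating the trace of a matrix quotient -/

section MatrixTrace

attribute [local instance] Matrix.linftyOpNormedRing Matrix.linftyOpNormedAlgebra

variable {E : Type*} [NormedAddCommGroup E] [NormedSpace ℝ E] {n : ℕ}

/-- Passes from entrywise derivatives to a Fréchet derivative in the normed ring of matrices, where
inversion can be differentiated. -/
theorem hasFDerivAt_matrix {g : E → Matrix (Fin n) (Fin n) ℝ} {z : E}
    (hg : ∀ i j, DifferentiableAt ℝ (fun y => g y i j) z) :
    ∃ g' : E →L[ℝ] Matrix (Fin n) (Fin n) ℝ, HasFDerivAt g g' z ∧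
      ∀ v i j, g' v i j = dirD v (fun y => g y i j) z := by
  refine ⟨∑ i, ∑ j, (fderiv ℝ (fun y => g y i j) z).smulRight (Matrix.single i j (1 : ℝ)), ?_, ?_⟩
  · have h : g = fun y => ∑ i, ∑ j, g y i j • Matrix.single i j (1 : ℝ) := by
      funext y
      conv_lhs => rw [Matrix.matrix_eq_sum_single (g y)]
      simp
    have h2 : HasFDerivAt (fun y => ∑ i, ∑ j, g y i j • Matrix.single i j (1 : ℝ))
        (∑ i, ∑ j, (fderiv ℝ (fun y => g y i j) z).smulRight (Matrix.single i j (1 : ℝ))) z :=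
      HasFDerivAt.fun_sum fun i _ => HasFDerivAt.fun_sum fun j _ =>
        (hg i j).hasFDerivAt.smul_const _
    rwa [← h] at h2
  · intro v i j
    have key : (∑ i, ∑ j, (fderiv ℝ (fun y => g y i j) z).smulRight
        (Matrix.single i j (1 : ℝ))) v
        = Matrix.of fun i j => dirD v (fun y => g y i j) z := by
      rw [Matrix.matrix_eq_sum_single (Matrix.of fun i j => dirD v (fun y => g y i j) z)]
      simp [dirD]
    rw [key]
    rfl

/-- The derivative of `tr (g⁻¹ h)` at a point where `g` is the identity. -/
theorem dirD_trace_inv_mul {g h : E → Matrix (Fin n) (Fin n) ℝ} {z : E}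
    (hg : ∀ i j, DifferentiableAt ℝ (fun y => g y i j) z)
    (hh : ∀ i j, DifferentiableAt ℝ (fun y => h y i j) z) (h1 : g z = 1) :
    DifferentiableAt ℝ (fun y => ((g y)⁻¹ * h y).trace) z ∧
      ∀ v, dirD v (fun y => ((g y)⁻¹ * h y).trace) z
        = ∑ i, dirD v (fun y => h y i i) z
          - ∑ i, ∑ j, dirD v (fun y => g y i j) z * h z j i := by
  obtain ⟨g', hg', hge⟩ := hasFDerivAt_matrix hg
  obtain ⟨h', hh', hhe⟩ := hasFDerivAt_matrix hh
  have : CompleteSpace (Matrix (Fin n) (Fin n) ℝ) := FiniteDimensional.complete ℝ _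
  have hinv : HasFDerivAt (fun y => (g y)⁻¹) (-g') z := by
    have h0 := hasFDerivAt_ringInverse (𝕜 := ℝ) (1 : (Matrix (Fin n) (Fin n) ℝ)ˣ)
    rw [inv_one, Units.val_one] at h0
    -- Only the base point of the derivative is rewritten as `g z`, so that the chain rule applies.
    nth_rewrite 3 [← h1] at h0
    have h2 := h0.comp z hg'
    refine (h2.congr_of_eventuallyEq ?_).congr_fderiv ?_
    · exact Eventually.of_forall fun y => Matrix.nonsing_inv_eq_ringInverse (g y)
    · ext v : 1
      change -((1 : Matrix (Fin n) (Fin n) ℝ) * g' v * 1) = -(g' v)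
      rw [one_mul, mul_one]
  have htr : HasFDerivAt (fun y => ((g y)⁻¹ * h y).trace) _ z :=
    ((Matrix.traceLinearMap (Fin n) ℝ ℝ).toContinuousLinearMap.hasFDerivAt).comp z
      (hinv.mul' hh')
  refine ⟨htr.differentiableAt, fun v => ?_⟩
  have hv : dirD v (fun y => ((g y)⁻¹ * h y).trace) z
      = ((g z)⁻¹ * h' v + -g' v * h z).trace := by
    unfold dirD
    rw [htr.fderiv]
    rfl
  rw [hv, h1]
  simp [Matrix.trace, Matrix.mul_apply, hge, hhe, sub_eq_add_neg, Finset.sum_add_distrib]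

end MatrixTrace

/-! ### Coordinate invariance of the mean curvature -/

section Coordinates

variable {n : ℕ}

/-- The coordinate vector `eᵢ` of `ℝⁿ`. -/
abbrev coordVec (i : Fin n) : EuclideanSpace ℝ (Fin n) := EuclideanSpace.single i 1

/-- First fundamental form of a parametrization `x` of a hypersurface over `ℝⁿ`. -/
def coordFirstForm (x : EuclideanSpace ℝ (Fin n) → Amb n) (z : EuclideanSpace ℝ (Fin n)) :
    Matrix (Fin n) (Fin n) ℝ :=
  Matrix.of fun i j => inner ℝ (dirD (coordVec i) x z) (dirD (coordVec j) x z)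

/-- Second fundamental form of a parametrization `x` of a hypersurface over `ℝⁿ`. -/
def coordSecondForm (x : EuclideanSpace ℝ (Fin n) → Amb n) (N : Amb n)
    (z : EuclideanSpace ℝ (Fin n)) : Matrix (Fin n) (Fin n) ℝ :=
  Matrix.of fun i j => -inner ℝ (dirD (coordVec i) (dirD (coordVec j) x) z) N

/-- Mean curvature of a parametrization `x` of a hypersurface over `ℝⁿ`. -/
def coordMeanCurvature (x : EuclideanSpace ℝ (Fin n) → Amb n) (N : Amb n)
    (z : EuclideanSpace ℝ (Fin n)) : ℝ :=
  ((coordFirstForm x z)⁻¹ * coordSecondForm x N z).trace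

theorem meanCurvature_eq_coordMeanCurvature {M : Type*} [TopologicalSpace M]
    [ChartedSpace (EuclideanSpace ℝ (Fin n)) M] (X : M → Amb n) (N : Amb n) (p : M) :
    meanCurvature X N p = coordMeanCurvature (localRep X p) N (extChartAt (𝓡 n) p p) := rfl

theorem eq_sum_coordVec (v : EuclideanSpace ℝ (Fin n)) : v = ∑ k, v k • coordVec k := by
  ext j
  simp [Pi.single_apply]

/-- The mean curvature does not depend on the coordinates. -/
theorem coordMeanCurvature_comp {x : EuclideanSpace ℝ (Fin n) → Amb n}
    {ψ : EuclideanSpace ℝ (Fin n) → EuclideanSpace ℝ (Fin n)} {y : EuclideanSpace ℝ (Fin n)}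
    {N : Amb n} (hx : ContDiffAt ℝ 2 x (ψ y)) (hψ : ContDiffAt ℝ 2 ψ y)
    {L : EuclideanSpace ℝ (Fin n) →L[ℝ] EuclideanSpace ℝ (Fin n)}
    (hL : (fderiv ℝ ψ y).comp L = ContinuousLinearMap.id ℝ _)
    (hN : ∀ w, inner ℝ (dirD w x (ψ y)) N = 0) :
    coordMeanCurvature (x ∘ ψ) N y = coordMeanCurvature x N (ψ y) := by
  set J : Matrix (Fin n) (Fin n) ℝ := Matrix.of fun k i => fderiv ℝ ψ y (coordVec i) k with hJ
  set K : Matrix (Fin n) (Fin n) ℝ := Matrix.of fun k i => L (coordVec i) k with hK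
  have hexp : ∀ i, fderiv ℝ ψ y (coordVec i) = ∑ k, J k i • coordVec k := fun i =>
    eq_sum_coordVec _
  have hJK : J * K = 1 := by
    ext i j
    have h := congrArg (fun A : EuclideanSpace ℝ (Fin n) →L[ℝ] EuclideanSpace ℝ (Fin n) =>
      A (coordVec j) i) hL
    have h2 : L (coordVec j) = ∑ k, K k j • coordVec k := eq_sum_coordVec _
    simp only [ContinuousLinearMap.comp_apply, h2, map_sum, map_smul] at h
    simpa [Matrix.mul_apply, hJ, mul_comm, Matrix.one_apply, Pi.single_apply] using h
  have hJdet : IsUnit J.det := (Matrix.isUnit_iff_isUnit_det J).1 (IsUnit.of_mul_eq_one K hJK)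
  have hd1 : ∀ v, dirD v (x ∘ ψ) =ᶠ[𝓝 y] fun y' => fderiv ℝ x (ψ y') (fderiv ℝ ψ y' v) := by
    intro v
    filter_upwards [eventually_contDiffAt (k := 2) hψ,
      hψ.continuousAt.eventually (eventually_contDiffAt (k := 2) hx)] with y' h1 h2
    unfold dirD
    rw [fderiv_comp y' (h2.differentiableAt (by norm_num)) (h1.differentiableAt (by norm_num))]
    rfl
  have hdx : DifferentiableAt ℝ (fderiv ℝ x) (ψ y) :=
    (hx.fderiv_right (m := 1) (by norm_num)).differentiableAt (by norm_num)
  have hdψ : DifferentiableAt ℝ (fderiv ℝ ψ) y :=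
    (hψ.fderiv_right (m := 1) (by norm_num)).differentiableAt (by norm_num)
  have hψd : DifferentiableAt ℝ ψ y := hψ.differentiableAt (by norm_num)
  have hg : coordFirstForm (x ∘ ψ) y = J.transpose * coordFirstForm x (ψ y) * J := by
    ext i j
    simp only [coordFirstForm, Matrix.of_apply, (hd1 _).eq_of_nhds, hexp, map_sum, map_smul,
      sum_inner, inner_sum, inner_smul_left, inner_smul_right, Matrix.mul_apply,
      Matrix.transpose_apply, Finset.sum_mul]
    refine Finset.sum_congr rfl fun a _ => ?_
    rw [Finset.mul_sum]
    refine Finset.sum_congr rfl fun b _ => ?_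
    simp only [dirD, conj_trivial]
    ring
  have hh : coordSecondForm (x ∘ ψ) N y = J.transpose * coordSecondForm x N (ψ y) * J := by
    ext i j
    -- The second term, from the second derivative of `ψ`, is tangential, so pairing with `N`
    -- removes it and the second form transforms as a tensor.
    have h2 : dirD (coordVec i) (dirD (coordVec j) (x ∘ ψ)) y
        = fderiv ℝ (fderiv ℝ x) (ψ y) (fderiv ℝ ψ y (coordVec i)) (fderiv ℝ ψ y (coordVec j))
          + dirD (fderiv ℝ (fderiv ℝ ψ) y (coordVec i) (coordVec j)) x (ψ y) := by
      rw [dirD_congr _ (hd1 _)]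
      have e1 : HasFDerivAt (fun y' => fderiv ℝ x (ψ y'))
          ((fderiv ℝ (fderiv ℝ x) (ψ y)).comp (fderiv ℝ ψ y)) y :=
        hdx.hasFDerivAt.comp y hψd.hasFDerivAt
      have e2 := e1.clm_apply (hdψ.hasFDerivAt.clm_apply (hasFDerivAt_const (coordVec j) y))
      unfold dirD
      rw [e2.fderiv]
      simp [add_comm]
    simp only [coordSecondForm, Matrix.of_apply, h2, inner_add_left, hN, add_zero, hexp, map_sum,
      map_smul, _root_.sum_apply, _root_.smul_apply, sum_inner,
      inner_smul_left, Matrix.mul_apply, Matrix.transpose_apply, Finset.sum_mul,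
      dirD_dirD _ _ hx, ← Finset.sum_neg_distrib]
    refine Finset.sum_congr rfl fun a _ => ?_
    rw [Finset.mul_sum, ← Finset.sum_neg_distrib]
    refine Finset.sum_congr rfl fun b _ => ?_
    simp only [conj_trivial]
    ring
  have hJt : IsUnit J.transpose.det := by rwa [Matrix.det_transpose]
  unfold coordMeanCurvature
  rw [hg, hh, Matrix.mul_inv_rev, Matrix.mul_inv_rev]
  calc _ = (J⁻¹ * ((coordFirstForm x (ψ y))⁻¹ * ((J.transpose)⁻¹ * J.transpose)
        * coordSecondForm x N (ψ y) * J)).trace := by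
        simp only [Matrix.mul_assoc]
    _ = _ := by
      rw [Matrix.nonsing_inv_mul _ hJt, Matrix.mul_one, Matrix.trace_mul_comm,
        Matrix.mul_assoc, Matrix.mul_nonsing_inv _ hJdet, Matrix.mul_one]

end Coordinates

/-! ### The support function at a critical point -/

section SupportFunction

variable {n : ℕ} {x ν : EuclideanSpace ℝ (Fin n) → Amb n} {z : EuclideanSpace ℝ (Fin n)}

theorem coordFirstForm_eq_one (hon : Orthonormal ℝ fun i => dirD (coordVec i) x z) :
    coordFirstForm x z = 1 := by
  ext i j
  simp [coordFirstForm, orthonormal_iff_ite.1 hon i j, Matrix.one_apply]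

theorem differentiableAt_coordFirstForm (hx : ContDiffAt ℝ 3 x z) (i j : Fin n) :
    DifferentiableAt ℝ (fun y => coordFirstForm x y i j) z := by
  have h : ∀ k : Fin n, DifferentiableAt ℝ (dirD (coordVec k) x) z := fun k =>
    (contDiffAt_dirD (m := 2) _ hx (by norm_num)).differentiableAt (by norm_num)
  exact (h i).inner ℝ (h j)

theorem differentiableAt_coordSecondForm (hx : ContDiffAt ℝ 3 x z) (hν : ContDiffAt ℝ 2 ν z)
    (i j : Fin n) : DifferentiableAt ℝ (fun y => coordSecondForm x (ν y) y i j) z := by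
  have h : DifferentiableAt ℝ (dirD (coordVec i) (dirD (coordVec j) x)) z :=
    (contDiffAt_dirD (m := 1) _ (contDiffAt_dirD (m := 2) _ hx (by norm_num))
      (by norm_num)).differentiableAt (by norm_num)
  exact (h.inner ℝ (hν.differentiableAt (by norm_num))).neg

/-- The Weingarten relation, from differentiating `⟨∂_w x, ν⟩ = 0` in the direction `v`. -/
theorem inner_dirD_normal (hx : ContDiffAt ℝ 2 x z) (hν : DifferentiableAt ℝ ν z)
    (horth : ∀ᶠ y in 𝓝 z, ∀ w, inner ℝ (dirD w x y) (ν y) = 0)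
    (v w : EuclideanSpace ℝ (Fin n)) :
    inner ℝ (dirD w x z) (dirD v ν z) = -inner ℝ (dirD v (dirD w x) z) (ν z) := by
  exact inner_dirD_of_orthogonal v
    ((contDiffAt_dirD (m := 1) w hx (by norm_num)).differentiableAt (by norm_num)) hν
    (horth.mono fun y hy => hy w)

/-- The support function `u = ⟨x, ν⟩` of a hypersurface satisfies
`Δu = H + ⟨x, ∇H⟩ - |A|² u` at its critical points, in coordinates orthonormal there. -/
theorem sum_dirD_dirD_support (hx : ContDiffAt ℝ 3 x z) (hν : ContDiffAt ℝ 2 ν z)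
    (horth : ∀ᶠ y in 𝓝 z, ∀ w, inner ℝ (dirD w x y) (ν y) = 0)
    (hunit : ∀ᶠ y in 𝓝 z, ‖ν y‖ = 1)
    (hon : Orthonormal ℝ fun i => dirD (coordVec i) x z)
    (hcrit : ∀ v, dirD v (fun y => inner ℝ (x y) (ν y)) z = 0)
    {ξ : EuclideanSpace ℝ (Fin n)}
    (hξ : x z = (inner ℝ (x z) (ν z) : ℝ) • ν z + dirD ξ x z) :
    ∑ i, dirD (coordVec i) (dirD (coordVec i) fun y => inner ℝ (x y) (ν y)) z
      = coordMeanCurvature x (ν z) z + dirD ξ (fun y => coordMeanCurvature x (ν y) y) z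
        - inner ℝ (x z) (ν z) * ∑ i, ‖dirD (coordVec i) ν z‖ ^ 2 := by
  -- The coordinates need not be geodesic. The Christoffel terms of `Δu` multiply `du = 0`, and the
  -- first derivatives of the metric enter only through `∂_ξ H`.
  have hx2 : ContDiffAt ℝ 2 x z := hx.of_le (by norm_num)
  have hνd : DifferentiableAt ℝ ν z := hν.differentiableAt (by norm_num)
  have hxd : DifferentiableAt ℝ x z := hx.differentiableAt (by norm_num)
  have horth0 : ∀ w, inner ℝ (dirD w x z) (ν z) = 0 := horth.self_of_nhds
  have hunit0 : ‖ν z‖ = 1 := hunit.self_of_nhds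
  have hnt := inner_dirD_normal hx2 hνd horth
  have hnn : ∀ v, inner ℝ (ν z) (dirD v ν z) = 0 := fun v => inner_dirD_of_unit v hνd hunit
  have hexp := eq_normal_add_tangential hon hunit0 fun i => horth0 _
  have hxν : ∀ v, inner ℝ (x z) (dirD v ν z) = 0 := by
    intro v
    have h := hcrit v
    rw [dirD_inner v hxd hνd, horth0, add_zero] at h
    exact h
  -- the normal does not turn in the direction `ξ`
  have hξν : dirD ξ ν z = 0 := by
    rw [hexp (dirD ξ ν z), hnn, zero_smul, zero_add]
    refine Finset.sum_eq_zero fun i _ => ?_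
    -- Symmetry of the second form: `⟨∂ᵢx, ∂_ξν⟩ = ⟨∂_ξx, ∂ᵢν⟩`, which equals `⟨x, ∂ᵢν⟩ = 0`.
    rw [hnt, dirD_comm _ _ hx2, ← hnt]
    have h := hxν (coordVec i)
    rw [hξ, inner_add_left, inner_smul_left, hnn, mul_zero, zero_add] at h
    rw [h, zero_smul]
  have hg1 := coordFirstForm_eq_one hon
  have hH : coordMeanCurvature x (ν z) z
      = ∑ i, -inner ℝ (dirD (coordVec i) (dirD (coordVec i) x) z) (ν z) := by
    simp [coordMeanCurvature, hg1, coordSecondForm, Matrix.trace]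
  -- second derivatives of `⟨x, ν⟩`, of `⟨∂_ξ x, ν⟩` and of `⟨ν, ν⟩`
  have hu : ∀ i, dirD (coordVec i) (dirD (coordVec i) fun y => inner ℝ (x y) (ν y)) z
      = inner ℝ (x z) (dirD (coordVec i) (dirD (coordVec i) ν) z)
        - inner ℝ (dirD (coordVec i) (dirD (coordVec i) x) z) (ν z) := by
    intro i
    rw [dirD_dirD_inner _ _ hx2 hν, hnt]
    ring
  have hνν : ∀ i, inner ℝ (ν z) (dirD (coordVec i) (dirD (coordVec i) ν) z)
      = -‖dirD (coordVec i) ν z‖ ^ 2 := by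
    intro i
    have h0 : (fun y => inner ℝ (ν y) (ν y)) =ᶠ[𝓝 z] fun _ => (1 : ℝ) :=
      hunit.mono fun y hy => by simp [hy]
    have h := dirD_congr (coordVec i) (dirD_eventuallyEq (coordVec i) h0)
    rw [dirD_dirD_inner _ _ hν hν, real_inner_self_eq_norm_sq, real_inner_comm (ν z), dirD_const,
      dirD_const] at h
    linarith
  have hξx : ∀ i, inner ℝ (dirD ξ x z) (dirD (coordVec i) (dirD (coordVec i) ν) z)
      = -inner ℝ (dirD (coordVec i) (dirD (coordVec i) (dirD ξ x)) z) (ν z)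
        - 2 * inner ℝ (dirD (coordVec i) (dirD ξ x) z) (dirD (coordVec i) ν z) := by
    intro i
    have h0 : (fun y => inner ℝ (dirD ξ x y) (ν y)) =ᶠ[𝓝 z] fun _ => (0 : ℝ) :=
      horth.mono fun y hy => hy ξ
    have h := dirD_congr (coordVec i) (dirD_eventuallyEq (coordVec i) h0)
    rw [dirD_dirD_inner _ _ (contDiffAt_dirD (m := 2) ξ hx (by norm_num)) hν] at h
    rw [dirD_const, dirD_const] at h
    linarith
  -- A contracted Codazzi identity: the `∂_ξ g` terms in the derivative of `tr (g⁻¹ h)` supply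
  -- exactly the cross terms of `hξx`.
  have hDH : dirD ξ (fun y => coordMeanCurvature x (ν y) y) z
      = ∑ i, inner ℝ (dirD ξ x z) (dirD (coordVec i) (dirD (coordVec i) ν) z) := by
    have h := (dirD_trace_inv_mul (differentiableAt_coordFirstForm hx)
      (differentiableAt_coordSecondForm hx hν) hg1).2 ξ
    have hcomm : ∀ v, dirD ξ (dirD v x) z = dirD v (dirD ξ x) z := fun v => dirD_comm _ _ hx2
    have hh : ∀ i, dirD ξ (fun y => coordSecondForm x (ν y) y i i) z
        = -inner ℝ (dirD (coordVec i) (dirD (coordVec i) (dirD ξ x)) z) (ν z) := by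
      intro i
      have hd2 : ContDiffAt ℝ 2 (dirD (coordVec i) x) z :=
        contDiffAt_dirD (m := 2) _ hx (by norm_num)
      have hd3 : DifferentiableAt ℝ (dirD (coordVec i) (dirD (coordVec i) x)) z :=
        (contDiffAt_dirD (m := 1) _ hd2 (by norm_num)).differentiableAt (by norm_num)
      have h3 : dirD ξ (dirD (coordVec i) (dirD (coordVec i) x)) z
          = dirD (coordVec i) (dirD (coordVec i) (dirD ξ x)) z := by
        rw [dirD_comm _ _ hd2]
        refine dirD_congr _ ?_
        filter_upwards [eventually_contDiffAt (k := 2) hx2] with y hy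
        exact dirD_comm _ _ hy
      have h4 : dirD ξ (fun y => inner ℝ (dirD (coordVec i) (dirD (coordVec i) x) y) (ν y)) z
          = inner ℝ (dirD (coordVec i) (dirD (coordVec i) (dirD ξ x)) z) (ν z) := by
        rw [dirD_inner _ hd3 hνd, hξν, inner_zero_right, zero_add, h3]
      rw [← h4]
      simp [coordSecondForm, dirD, fderiv_fun_neg]
    have hgd : ∀ i j, dirD ξ (fun y => coordFirstForm x y i j) z
        = inner ℝ (dirD (coordVec i) x z) (dirD (coordVec j) (dirD ξ x) z)
          + inner ℝ (dirD (coordVec i) (dirD ξ x) z) (dirD (coordVec j) x z) := by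
      intro i j
      have hd : ∀ k : Fin n, DifferentiableAt ℝ (dirD (coordVec k) x) z := fun k =>
        (contDiffAt_dirD (m := 2) _ hx (by norm_num)).differentiableAt (by norm_num)
      rw [← hcomm, ← hcomm]
      exact dirD_inner ξ (hd i) (hd j)
    have hA : ∀ i j, coordSecondForm x (ν z) z i j
        = inner ℝ (dirD (coordVec j) x z) (dirD (coordVec i) ν z) := fun i j => by
      rw [hnt]; rfl
    have hsymm : ∀ i j, coordSecondForm x (ν z) z i j = coordSecondForm x (ν z) z j i :=
      fun i j => by simp only [coordSecondForm, Matrix.of_apply, dirD_comm _ _ hx2]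
    have hcontr : ∀ i, ∑ j, inner ℝ (dirD (coordVec i) (dirD ξ x) z) (dirD (coordVec j) x z)
        * coordSecondForm x (ν z) z i j
        = inner ℝ (dirD (coordVec i) (dirD ξ x) z) (dirD (coordVec i) ν z) := by
      intro i
      conv_rhs => rw [hexp (dirD (coordVec i) ν z)]
      rw [hnn, zero_smul, zero_add, inner_sum]
      refine Finset.sum_congr rfl fun j _ => ?_
      rw [inner_smul_right, hA, mul_comm]
    have hsum : ∑ i, ∑ j, dirD ξ (fun y => coordFirstForm x y i j) z
        * coordSecondForm x (ν z) z j i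
        = 2 * ∑ i, inner ℝ (dirD (coordVec i) (dirD ξ x) z) (dirD (coordVec i) ν z) := by
      simp only [hgd, add_mul, Finset.sum_add_distrib, two_mul]
      congr 1
      · rw [Finset.sum_comm]
        refine Finset.sum_congr rfl fun j _ => ?_
        rw [← hcontr]
        exact Finset.sum_congr rfl fun i _ => by rw [real_inner_comm]
      · refine Finset.sum_congr rfl fun i _ => ?_
        rw [← hcontr]
        exact Finset.sum_congr rfl fun j _ => by rw [hsymm]
    refine h.trans ?_
    rw [hsum, Finset.mul_sum, ← Finset.sum_sub_distrib]
    exact Finset.sum_congr rfl fun i _ => by rw [hh, hξx]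
  rw [hDH, hH, Finset.mul_sum, ← Finset.sum_add_distrib, ← Finset.sum_sub_distrib]
  refine Finset.sum_congr rfl fun i _ => ?_
  rw [hu]
  conv_lhs => rw [hξ]
  rw [inner_add_left, inner_smul_left, hνν, conj_trivial]
  ring

/-- `H² ≤ n |A|²`, in coordinates orthonormal at the point. -/
theorem sq_coordMeanCurvature_le (hx : ContDiffAt ℝ 2 x z) (hν : DifferentiableAt ℝ ν z)
    (horth : ∀ᶠ y in 𝓝 z, ∀ w, inner ℝ (dirD w x y) (ν y) = 0)
    (hon : Orthonormal ℝ fun i => dirD (coordVec i) x z) :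
    coordMeanCurvature x (ν z) z ^ 2 ≤ n * ∑ i, ‖dirD (coordVec i) ν z‖ ^ 2 := by
  have hH : coordMeanCurvature x (ν z) z
      = ∑ i, inner ℝ (dirD (coordVec i) x z) (dirD (coordVec i) ν z) := by
    simp [coordMeanCurvature, coordFirstForm_eq_one hon, coordSecondForm, Matrix.trace,
      inner_dirD_normal hx hν horth]
  rw [hH]
  refine (sq_sum_le_card_mul_sum_sq).trans ?_
  rw [Finset.card_univ, Fintype.card_fin]
  refine mul_le_mul_of_nonneg_left (Finset.sum_le_sum fun i _ => ?_) n.cast_nonneg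
  have h := abs_real_inner_le_norm (dirD (coordVec i) x z) (dirD (coordVec i) ν z)
  rw [hon.1 i, one_mul] at h
  rw [← sq_abs]
  gcongr

/-- At a spatial minimum of the support function `u > 0`, `-H + ⟨x, ∇H⟩ ≥ -n / u`. -/
theorem neg_div_le_of_isLocalMin_support (hn : 1 ≤ n) (hx : ContDiffAt ℝ 3 x z)
    (hν : ContDiffAt ℝ 2 ν z)
    (horth : ∀ᶠ y in 𝓝 z, ∀ w, inner ℝ (dirD w x y) (ν y) = 0)
    (hunit : ∀ᶠ y in 𝓝 z, ‖ν y‖ = 1)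
    (hon : Orthonormal ℝ fun i => dirD (coordVec i) x z)
    (hmin : IsLocalMin (fun y => (inner ℝ (x y) (ν y) : ℝ)) z)
    (hpos : 0 < inner ℝ (x z) (ν z)) {W : Amb n} (hWν : inner ℝ W (ν z) = 0)
    (hW : ∀ w, inner ℝ W (dirD w x z) = dirD w (fun y => coordMeanCurvature x (ν y) y) z) :
    -(n / inner ℝ (x z) (ν z)) ≤ -coordMeanCurvature x (ν z) z + inner ℝ (x z) W := by
  have hu2 : ContDiffAt ℝ 2 (fun y => (inner ℝ (x y) (ν y) : ℝ)) z :=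
    (hx.of_le (by norm_num)).inner ℝ hν
  have hunit0 : ‖ν z‖ = 1 := hunit.self_of_nhds
  have hcrit : ∀ v, dirD v (fun y => (inner ℝ (x y) (ν y) : ℝ)) z = 0 := by
    intro v
    simp [dirD, hmin.fderiv_eq_zero]
  obtain ⟨ξ, hξ⟩ : ∃ ξ, x z = (inner ℝ (x z) (ν z) : ℝ) • ν z + dirD ξ x z := by
    refine ⟨∑ i, (inner ℝ (dirD (coordVec i) x z) (x z) : ℝ) • coordVec i, ?_⟩
    have h := eq_normal_add_tangential hon hunit0 (fun i => horth.self_of_nhds _) (x z)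
    rw [real_inner_comm] at h
    simpa [dirD] using h
  have hid := sum_dirD_dirD_support hx hν horth hunit hon hcrit hξ
  have hnonneg : 0 ≤ ∑ i, dirD (coordVec i) (dirD (coordVec i) fun y =>
      (inner ℝ (x y) (ν y) : ℝ)) z :=
    Finset.sum_nonneg fun i _ => dirD_dirD_nonneg_of_isLocalMin _ hu2 hmin
  have hxW : inner ℝ (x z) W = dirD ξ (fun y => coordMeanCurvature x (ν y) y) z := by
    rw [← hW ξ]
    conv_lhs => rw [hξ]
    rw [inner_add_left, inner_smul_left, real_inner_comm W, hWν, mul_zero, zero_add,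
      real_inner_comm]
  have hA := sq_coordMeanCurvature_le (hx.of_le (by norm_num)) (hν.differentiableAt (by norm_num))
    horth hon
  rw [hxW]
  set u : ℝ := inner ℝ (x z) (ν z)
  set H := coordMeanCurvature x (ν z) z
  set A := ∑ i, ‖dirD (coordVec i) ν z‖ ^ 2
  have hn0 : (0 : ℝ) < n := by exact_mod_cast hn
  -- Replace `A` by `H² / n` and complete the square.
  have h1 : 0 ≤ n / u - 2 * H + u * A := by
    have h2 : u * (H ^ 2 / n) ≤ u * A := by
      gcongr
      rw [div_le_iff₀ hn0]
      linarith
    have h3 : n / u - 2 * H + u * (H ^ 2 / n) = (n - u * H) ^ 2 / (n * u) := by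
      field_simp
      ring
    have h4 : 0 ≤ (n - u * H) ^ 2 / (n * u) := by positivity
    linarith
  linarith

end SupportFunction

/-! ### Smoothness of the normal and evolution of the support function -/

/-- A continuous unit normal field to a smoothly varying family of hyperplanes is smooth. -/
theorem contDiffAt_normal {P : Type*} [NormedAddCommGroup P] [NormedSpace ℝ P] {n : ℕ}
    {m : WithTop ℕ∞} {B : Fin n → P → Amb n} {N : P → Amb n} {a : P}
    (hB : ∀ i, ContDiffAt ℝ m (B i) a) (hon : Orthonormal ℝ fun i => B i a)
    (hN : ContinuousAt N a) (hunit : ∀ᶠ q in 𝓝 a, ‖N q‖ = 1)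
    (horth : ∀ᶠ q in 𝓝 a, ∀ i, inner ℝ (B i q) (N q) = 0) : ContDiffAt ℝ m N a := by
  -- `L q` sends `N q` to a multiple of `N a`, and `L a` is the identity. Hence `N q` is a multiple
  -- of `(L q)⁻¹ (N a)`, which depends smoothly on `q`; unit length and continuity fix the factor.
  set L : P → Amb n →L[ℝ] Amb n := fun q =>
    (innerSL ℝ (N a)).smulRight (N a) + ∑ i, (innerSL ℝ (B i q)).smulRight (B i a) with hL
  have hLd : ContDiffAt ℝ m L a := by
    refine contDiffAt_const.add (ContDiffAt.sum fun i _ => ?_)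
    exact ((innerSL ℝ (E := Amb n)).contDiff.contDiffAt.comp a (hB i)).smulRight contDiffAt_const
  have hL1 : L a = 1 := by
    ext1 v
    have h := eq_normal_add_tangential hon hunit.self_of_nhds horth.self_of_nhds v
    simpa [hL] using h.symm
  have hinv : ContDiffAt ℝ m (Ring.inverse (M₀ := Amb n →L[ℝ] Amb n)) (L a) := by
    rw [hL1]
    exact contDiffAt_ringInverse ℝ (1 : (Amb n →L[ℝ] Amb n)ˣ)
  set R : P → Amb n := fun q => Ring.inverse (L q) (N a) with hR
  have hRd : ContDiffAt ℝ m R a := (hinv.comp a hLd).clm_apply contDiffAt_const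
  have hRa : R a = N a := by simp [hR, hL1]
  have hRne : R a ≠ 0 := by
    rw [hRa, ← norm_ne_zero_iff, hunit.self_of_nhds]
    exact one_ne_zero
  have hpos : ∀ᶠ q in 𝓝 a, 0 < inner ℝ (N a) (N q) := by
    have hc : ContinuousAt (fun q => (inner ℝ (N a) (N q) : ℝ)) a := ContinuousAt.inner continuousAt_const hN
    refine hc.eventually_const_lt (u := 0) ?_
    simp [hunit.self_of_nhds]
  have hLu : ∀ᶠ q in 𝓝 a, IsUnit (L q) :=
    hLd.continuousAt.eventually (Units.isOpen.mem_nhds (by rw [hL1]; exact isUnit_one))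
  have heq : N =ᶠ[𝓝 a] fun q => ‖R q‖⁻¹ • R q := by
    filter_upwards [hunit, horth, hpos, hLu] with q h1 h2 h3 h4
    have hLN : L q (N q) = (inner ℝ (N a) (N q) : ℝ) • N a := by simp [hL, h2]
    have hNR : N q = (inner ℝ (N a) (N q) : ℝ) • R q := by
      have h := congrArg (fun v => Ring.inverse (L q) v) hLN
      rw [← mul_apply_eq_comp, Ring.inverse_mul_cancel _ h4, map_smul] at h
      exact h
    have hnorm : inner ℝ (N a) (N q) * ‖R q‖ = 1 := by
      rw [← h1]
      conv_rhs => rw [hNR]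
      rw [norm_smul, Real.norm_of_nonneg h3.le]
    rw [← eq_inv_of_mul_eq_one_left hnorm]
    exact hNR
  refine ContDiffAt.congr_of_eventuallyEq ?_ heq
  exact ((hRd.norm ℝ hRne).inv (norm_ne_zero_iff.2 hRne)).smul hRd

/-- At a positive spatial minimum of the support function `u` of a mean curvature flow,
`∂u/∂t ≥ -n / u`. -/
theorem support_deriv_ge_of_isLocalMin {n : ℕ} (hn : 1 ≤ n)
    {X N : EuclideanSpace ℝ (Fin n) × ℝ → Amb n} {z : EuclideanSpace ℝ (Fin n)} {t : ℝ}
    (hX : ContDiffAt ℝ 3 X (z, t)) (hN : ContDiffAt ℝ 2 N (z, t))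
    (hunit : ∀ᶠ q in 𝓝 (z, t), ‖N q‖ = 1)
    (horth : ∀ᶠ q in 𝓝 (z, t), ∀ w, inner ℝ (dirD (w, (0 : ℝ)) X q) (N q) = 0)
    (hon : Orthonormal ℝ fun i => dirD (coordVec i, (0 : ℝ)) X (z, t))
    (hevol : ∀ᶠ y in 𝓝 z, dirD (0, (1 : ℝ)) X (y, t)
      = -(coordMeanCurvature (fun y => X (y, t)) (N (y, t)) y) • N (y, t))
    (hmin : IsLocalMin (fun y => (inner ℝ (X (y, t)) (N (y, t)) : ℝ)) z)
    (hpos : 0 < inner ℝ (X (z, t)) (N (z, t))) :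
    ∃ u' : ℝ, HasDerivAt (fun s => (inner ℝ (X (z, s)) (N (z, s)) : ℝ)) u' t ∧
      -(n / inner ℝ (X (z, t)) (N (z, t))) ≤ u' := by
  set x : EuclideanSpace ℝ (Fin n) → Amb n := fun y => X (y, t) with hxdef
  set ν : EuclideanSpace ℝ (Fin n) → Amb n := fun y => N (y, t) with hνdef
  set W : Amb n := dirD (0, (1 : ℝ)) N (z, t)
  have hX2 : ContDiffAt ℝ 2 X (z, t) := hX.of_le (by norm_num)
  have hXd : DifferentiableAt ℝ X (z, t) := hX.differentiableAt (by norm_num)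
  have hNd : DifferentiableAt ℝ N (z, t) := hN.differentiableAt (by norm_num)
  have hι : ContDiff ℝ ω fun y : EuclideanSpace ℝ (Fin n) => (y, t) := by fun_prop
  have hιt : Tendsto (fun y : EuclideanSpace ℝ (Fin n) => (y, t)) (𝓝 z) (𝓝 (z, t)) :=
    hι.continuous.tendsto z
  have hx : ContDiffAt ℝ 3 x z := hX.comp z (hι.contDiffAt.of_le le_top)
  have hν : ContDiffAt ℝ 2 ν z := hN.comp z (hι.contDiffAt.of_le le_top)
  have hνd : DifferentiableAt ℝ ν z := hν.differentiableAt (by norm_num)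
  have hslice : ∀ᶠ y in 𝓝 z, ∀ w, dirD w x y = dirD (w, (0 : ℝ)) X (y, t) := by
    filter_upwards [hιt.eventually (eventually_contDiffAt (k := 3) hX)] with y hy w
    exact dirD_slice w (hy.differentiableAt (by norm_num))
  have horth' : ∀ᶠ y in 𝓝 z, ∀ w, inner ℝ (dirD w x y) (ν y) = 0 := by
    filter_upwards [hslice, hιt.eventually horth] with y h1 h2 w
    rw [h1]
    exact h2 w
  have hunit' : ∀ᶠ y in 𝓝 z, ‖ν y‖ = 1 := hιt.eventually hunit
  have hon' : Orthonormal ℝ fun i => dirD (coordVec i) x z := by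
    simpa only [hslice.self_of_nhds] using hon
  have hHd : DifferentiableAt ℝ (fun y => coordMeanCurvature x (ν y) y) z :=
    (dirD_trace_inv_mul (differentiableAt_coordFirstForm hx)
      (differentiableAt_coordSecondForm hx hν) (coordFirstForm_eq_one hon')).1
  have hWν : inner ℝ W (ν z) = 0 := by
    rw [real_inner_comm]
    exact inner_dirD_of_unit _ hNd hunit
  -- This is `∂ₜν = ∇H`: `⟨∂ₜν, ∂_w x⟩ = -⟨ν, ∂_w ∂ₜx⟩ = ⟨ν, ∂_w (Hν)⟩ = ∂_w H`.
  have hW : ∀ w, inner ℝ W (dirD w x z) = dirD w (fun y => coordMeanCurvature x (ν y) y) z := by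
    intro w
    have hVd : DifferentiableAt ℝ (dirD ((0 : EuclideanSpace ℝ (Fin n)), (1 : ℝ)) X) (z, t) :=
      (contDiffAt_dirD (m := 1) _ hX2 (by norm_num)).differentiableAt (by norm_num)
    have h1 : dirD w (fun y => dirD ((0 : EuclideanSpace ℝ (Fin n)), (1 : ℝ)) X (y, t)) z
        = -(coordMeanCurvature x (ν z) z) • dirD w ν z
          + -(dirD w (fun y => coordMeanCurvature x (ν y) y) z) • ν z := by
      rw [dirD_congr w hevol]
      have h2 := hHd.hasFDerivAt.neg.smul hνd.hasFDerivAt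
      have h3 := congrArg (fun A : EuclideanSpace ℝ (Fin n) →L[ℝ] Amb n => A w) h2.fderiv
      exact h3
    rw [real_inner_comm, hslice.self_of_nhds,
      inner_dirD_of_orthogonal (0, (1 : ℝ)) ((contDiffAt_dirD (m := 1) _ hX2
        (by norm_num)).differentiableAt (by norm_num)) hNd (horth.mono fun q hq => hq w),
      dirD_comm _ _ hX2, ← dirD_slice w hVd, h1, inner_add_left, inner_smul_left,
      inner_smul_left, real_inner_comm]
    have h5 : inner ℝ (ν z) (dirD w ν z) = 0 := inner_dirD_of_unit w hνd hunit'
    have h6 : inner ℝ (ν z) (ν z) = (1 : ℝ) := by simp [hunit'.self_of_nhds]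
    change -(_ * inner ℝ (ν z) (dirD w ν z) + _ * inner ℝ (ν z) (ν z)) = _
    rw [h5, h6]
    simp
  refine ⟨_, (hasDerivAt_slice hXd).inner ℝ (hasDerivAt_slice hNd), ?_⟩
  have h := neg_div_le_of_isLocalMin_support hn hx hν horth' hunit' hon' hmin hpos hWν hW
  refine h.trans (le_of_eq ?_)
  have h6 : inner ℝ (ν z) (ν z) = (1 : ℝ) := by simp [hunit'.self_of_nhds]
  rw [hevol.self_of_nhds, inner_smul_left]
  change _ = inner ℝ (x z) W + _ * inner ℝ (ν z) (ν z)
  rw [h6]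
  simp [hνdef, add_comm]

theorem coordMeanCurvature_congr {n : ℕ} {x x' : EuclideanSpace ℝ (Fin n) → Amb n} {N : Amb n}
    {z : EuclideanSpace ℝ (Fin n)} (h : x =ᶠ[𝓝 z] x') :
    coordMeanCurvature x N z = coordMeanCurvature x' N z := by
  have h1 : coordFirstForm x z = coordFirstForm x' z := by
    ext i j
    simp only [coordFirstForm, Matrix.of_apply, dirD_congr _ h]
  have h2 : coordSecondForm x N z = coordSecondForm x' N z := by
    ext i j
    simp only [coordSecondForm, Matrix.of_apply, dirD_congr _ (dirD_eventuallyEq _ h)]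
  rw [coordMeanCurvature, coordMeanCurvature, h1, h2]

theorem natCast_le_infty (k : ℕ) : (k : WithTop ℕ∞) ≤ ∞ := mod_cast le_top

/-! ### Transfer from coordinates to the manifold -/

section Manifold

variable {n : ℕ} {M : Type*} [TopologicalSpace M] [ChartedSpace (EuclideanSpace ℝ (Fin n)) M]
  [IsManifold (𝓡 n) ∞ M]

/-- The mean curvature can be computed in any smooth local parametrization `c` of `M`. -/
theorem meanCurvature_eq_of_param {X : M → Amb n} {N : Amb n}
    {c : EuclideanSpace ℝ (Fin n) → M} {d : M → EuclideanSpace ℝ (Fin n)}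
    {z : EuclideanSpace ℝ (Fin n)}
    (hc : ContMDiffAt 𝓘(ℝ, EuclideanSpace ℝ (Fin n)) (𝓡 n) ∞ c z)
    (hd : ContMDiffAt (𝓡 n) 𝓘(ℝ, EuclideanSpace ℝ (Fin n)) ∞ d (c z))
    (hcd : ∀ᶠ r in 𝓝 (c z), c (d r) = r) (hdc : ∀ᶠ y in 𝓝 z, d (c y) = y)
    (hX : ContMDiffAt (𝓡 n) 𝓘(ℝ, Amb n) ∞ X (c z))
    (hN : ∀ w, inner ℝ (dirD w (X ∘ c) z) N = 0) :
    meanCurvature X N (c z) = coordMeanCurvature (X ∘ c) N z := by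
  set q := c z with hq
  set φ := extChartAt (𝓡 n) q with hφ
  have hφs : ContMDiffAt 𝓘(ℝ, EuclideanSpace ℝ (Fin n)) (𝓡 n) ∞ φ.symm (φ q) :=
    (contMDiffOn_extChartAt_symm q).contMDiffAt (extChartAt_target_mem_nhds q)
  have hφq : φ.symm (φ q) = q := extChartAt_to_inv q
  have hψ : ContDiffAt ℝ ∞ (fun y => d (φ.symm y)) (φ q) := by
    rw [← contMDiffAt_iff_contDiffAt]
    exact ContMDiffAt.comp (φ q) (by rwa [hφq]) hφs
  have hχ : ContDiffAt ℝ ∞ (fun y => φ (c y)) z := by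
    rw [← contMDiffAt_iff_contDiffAt]
    exact ContMDiffAt.comp z contMDiffAt_extChartAt hc
  have hx : ContDiffAt ℝ ∞ (X ∘ c) z := by
    rw [← contMDiffAt_iff_contDiffAt]
    exact ContMDiffAt.comp z hX hc
  have hψq : d (φ.symm (φ q)) = z := by
    rw [hφq]
    exact hdc.self_of_nhds
  have hloc : localRep X q =ᶠ[𝓝 (φ q)] (X ∘ c) ∘ fun y => d (φ.symm y) := by
    have ht : Tendsto φ.symm (𝓝 (φ q)) (𝓝 q) := by
      simpa only [hφq] using hφs.continuousAt.tendsto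
    filter_upwards [ht.eventually hcd] with y hy
    simp only [Function.comp, hy]
    rfl
  have hid : (fun y => d (φ.symm y)) ∘ (fun y => φ (c y)) =ᶠ[𝓝 z] id := by
    have h1 : ∀ᶠ y in 𝓝 z, c y ∈ φ.source :=
      hc.continuousAt.eventually (extChartAt_source_mem_nhds q)
    filter_upwards [h1, hdc] with y h2 h3
    simp [φ.left_inv h2, h3]
  have hder : (fderiv ℝ (fun y => d (φ.symm y)) (φ q)).comp (fderiv ℝ (fun y => φ (c y)) z)
      = ContinuousLinearMap.id ℝ _ := by
    rw [← fderiv_id (𝕜 := ℝ) (x := z), ← hid.fderiv_eq]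
    exact (fderiv_comp z (hψ.differentiableAt (by simp)) (hχ.differentiableAt (by simp))).symm
  rw [meanCurvature_eq_coordMeanCurvature, coordMeanCurvature_congr hloc,
    coordMeanCurvature_comp (ψ := fun y => d (φ.symm y)) ?_ ?_ hder ?_]
  · simp only [hψq]
  · simp only [hψq]
    exact hx.of_le (natCast_le_infty 2)
  · exact hψ.of_le (natCast_le_infty 2)
  · simp only [hψq]
    exact hN

/-- An injective linear map into a Euclidean space becomes isometric after a linear change of
variables. -/
theorem exists_equiv_comp_isometry {A : EuclideanSpace ℝ (Fin n) →L[ℝ] Amb n}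
    (hA : Function.Injective A) :
    ∃ E : EuclideanSpace ℝ (Fin n) ≃L[ℝ] EuclideanSpace ℝ (Fin n),
      Orthonormal ℝ fun i => A (E (coordVec i)) := by
  set S := LinearMap.range A.toLinearMap
  set e := LinearEquiv.ofInjective A.toLinearMap hA with he
  have hS : Module.finrank ℝ S = n := by
    rw [← e.finrank_eq]
    simp
  set b := (stdOrthonormalBasis ℝ S).reindex (finCongr hS)
  refine ⟨(b.repr.symm.toLinearEquiv.trans e.symm).toContinuousLinearEquiv, ?_⟩
  have h : ∀ i, A (e.symm (b.repr.symm (coordVec i))) = (b i : Amb n) := by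
    intro i
    rw [b.repr_symm_single]
    exact congrArg Subtype.val (e.apply_symm_apply (b i))
  have hb : Orthonormal ℝ fun i => (b i : Amb n) :=
    b.orthonormal.comp_linearIsometry S.subtypeₗᵢ
  change Orthonormal ℝ fun i => A (e.symm (b.repr.symm (coordVec i)))
  simpa only [h] using hb

/-- At a positive spatial minimum of the support function `u` of a mean curvature flow,
`∂u/∂t ≥ -n / u`. -/
theorem IsMeanCurvatureFlow.support_deriv_ge {Tc : ℝ} {F ν : M → ℝ → Amb n}
    (hF : IsMeanCurvatureFlow Tc F ν) (hn : 1 ≤ n) {p : M} {t : ℝ} (ht : t ∈ Ioo 0 Tc)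
    (hmin : IsLocalMin (fun q => (inner ℝ (F q t) (ν q t) : ℝ)) p)
    (hpos : 0 < inner ℝ (F p t) (ν p t)) :
    ∃ u' : ℝ, HasDerivAt (fun s => (inner ℝ (F p s) (ν p s) : ℝ)) u' t ∧
      -(n / inner ℝ (F p t) (ν p t)) ≤ u' := by
  set φ := extChartAt (𝓡 n) p with hφ
  have hFs : ∀ s ∈ Ioo 0 Tc, ∀ q, ContMDiffAt ((𝓡 n).prod 𝓘(ℝ, ℝ)) 𝓘(ℝ, Amb n) ∞
      (fun q : M × ℝ => F q.1 q.2) (q, s) := fun s hs q =>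
    hF.smooth.contMDiffAt (prod_mem_nhds univ_mem (Ico_mem_nhds hs.1 hs.2))
  have hFt : ∀ s ∈ Ioo 0 Tc, ∀ q, ContMDiffAt (𝓡 n) 𝓘(ℝ, Amb n) ∞ (fun q => F q s) q :=
    fun s hs q => ContMDiffAt.comp (g := fun q : M × ℝ => F q.1 q.2) q (hFs s hs q)
      (contMDiffAt_id.prodMk contMDiffAt_const)
  set A := fderiv ℝ (localRep (fun q => F q t) p) (φ p) with hAdef
  have hA : Function.Injective A := by
    have h := hF.immersion t (Ioo_subset_Ico_self ht) p
    rw [((hFt t ht p).mdifferentiableAt (by simp)).mfderiv, ModelWithCorners.range_eq_univ,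
      fderivWithin_univ] at h
    exact h
  obtain ⟨E, hE⟩ := exists_equiv_comp_isometry hA
  -- The chart at `p`, precomposed with an affine map so that `p` sits at `0` and the metric there
  -- at time `t` is the identity.
  set c : EuclideanSpace ℝ (Fin n) → M := fun z => φ.symm (φ p + E z) with hc
  set d : M → EuclideanSpace ℝ (Fin n) := fun q => E.symm (φ q - φ p) with hd
  have hc0 : c 0 = p := by simp [hc, hφ]
  have hgood : ∀ᶠ z in 𝓝 (0 : EuclideanSpace ℝ (Fin n)), φ p + E z ∈ φ.target := by
    have h : ContinuousAt (fun z => φ p + E z) 0 := by fun_prop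
    refine h.eventually ?_
    beta_reduce
    rw [map_zero, add_zero]
    exact extChartAt_target_mem_nhds (I := 𝓡 n) p
  have hcs : ∀ z, φ p + E z ∈ φ.target →
      ContMDiffAt 𝓘(ℝ, EuclideanSpace ℝ (Fin n)) (𝓡 n) ∞ c z := by
    intro z hz
    have h1 : ContMDiffAt 𝓘(ℝ, EuclideanSpace ℝ (Fin n)) (𝓡 n) ∞ φ.symm (φ p + E z) :=
      (contMDiffOn_extChartAt_symm p).contMDiffAt ((isOpen_extChartAt_target p).mem_nhds hz)
    have h2 : ContDiff ℝ ∞ fun z => φ p + E z := contDiff_const.add E.contDiff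
    exact ContMDiffAt.comp z h1 h2.contMDiff.contMDiffAt
  set X : EuclideanSpace ℝ (Fin n) × ℝ → Amb n := fun q => F (c q.1) q.2 with hX
  set N : EuclideanSpace ℝ (Fin n) × ℝ → Amb n := fun q => ν (c q.1) q.2 with hN
  have hXs : ∀ z, φ p + E z ∈ φ.target → ∀ s ∈ Ioo 0 Tc, ContDiffAt ℝ ∞ X (z, s) := by
    intro z hz s hs
    rw [← contMDiffAt_iff_contDiffAt, modelWithCornersSelf_prod, ← chartedSpaceSelf_prod]
    exact ContMDiffAt.comp (g := fun q : M × ℝ => F q.1 q.2) (z, s) (hFs s hs (c z))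
      ((ContMDiffAt.comp (z, s) (hcs z hz) contMDiffAt_fst).prodMk contMDiffAt_snd)
  have hgood2 : ∀ᶠ q in 𝓝 ((0 : EuclideanSpace ℝ (Fin n)), t),
      φ p + E q.1 ∈ φ.target ∧ q.2 ∈ Ioo 0 Tc :=
    hgood.prod_nhds (Ioo_mem_nhds ht.1 ht.2)
  have horthz : ∀ z, φ p + E z ∈ φ.target → ∀ s ∈ Ioo 0 Tc, ∀ w,
      inner ℝ (dirD w (fun y => F (c y) s) z) (ν (c z) s) = 0 := by
    intro z hz s hs w
    have h : mfderiv 𝓘(ℝ, EuclideanSpace ℝ (Fin n)) 𝓘(ℝ, Amb n) ((fun q => F q s) ∘ c) z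
        = (mfderiv (𝓡 n) 𝓘(ℝ, Amb n) (fun q => F q s) (c z)).comp
          (mfderiv 𝓘(ℝ, EuclideanSpace ℝ (Fin n)) (𝓡 n) c z) :=
      mfderiv_comp z ((hFt s hs _).mdifferentiableAt (by simp))
        ((hcs z hz).mdifferentiableAt (by simp))
    rw [mfderiv_eq_fderiv] at h
    have h2 : dirD w (fun y => F (c y) s) z
        = mfderiv (𝓡 n) 𝓘(ℝ, Amb n) (fun q => F q s) (c z)
          (mfderiv 𝓘(ℝ, EuclideanSpace ℝ (Fin n)) (𝓡 n) c z w) :=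
      congrArg (fun L : EuclideanSpace ℝ (Fin n) →L[ℝ] Amb n => L w) h
    rw [h2]
    exact hF.normal_orthogonal s (Ioo_subset_Ico_self hs) (c z) _
  have horth : ∀ᶠ q in 𝓝 ((0 : EuclideanSpace ℝ (Fin n)), t),
      ∀ w, inner ℝ (dirD (w, (0 : ℝ)) X q) (N q) = 0 := by
    filter_upwards [hgood2] with q hq w
    rw [← dirD_slice (z := q.1) (t := q.2) w
      ((hXs q.1 hq.1 q.2 hq.2).differentiableAt (by simp))]
    exact horthz q.1 hq.1 q.2 hq.2 w
  have hunit : ∀ᶠ q in 𝓝 ((0 : EuclideanSpace ℝ (Fin n)), t), ‖N q‖ = 1 := by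
    filter_upwards [hgood2] with q hq
    exact hF.normal_unit q.2 (Ioo_subset_Ico_self hq.2) _
  have hX0 : ContDiffAt ℝ ∞ X (0, t) := hXs 0 hgood.self_of_nhds t ht
  have hon : Orthonormal ℝ fun i : Fin n => dirD (coordVec i, (0 : ℝ)) X (0, t) := by
    have h : ∀ w, dirD (w, (0 : ℝ)) X (0, t) = A (E w) := by
      intro w
      rw [← dirD_slice w (hX0.differentiableAt (by simp))]
      have hl : DifferentiableAt ℝ (localRep (fun q => F q t) p) (φ p + E 0) := by
        have h1 : ContMDiffAt 𝓘(ℝ, EuclideanSpace ℝ (Fin n)) 𝓘(ℝ, Amb n) ∞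
            (localRep (fun q => F q t) p) (φ p + E 0) :=
          ContMDiffAt.comp (g := fun q => F q t) _ (hFt t ht _)
            ((contMDiffOn_extChartAt_symm p).contMDiffAt
              ((isOpen_extChartAt_target p).mem_nhds hgood.self_of_nhds))
        exact (contMDiffAt_iff_contDiffAt.1 h1).differentiableAt (by simp)
      have h2 := hl.hasFDerivAt.comp (0 : EuclideanSpace ℝ (Fin n))
        (E.hasFDerivAt.const_add (φ p))
      have h3 : dirD w (fun y => X (y, t)) 0
          = fderiv ℝ (localRep (fun q => F q t) p) (φ p + E 0) (E w) :=
        congrArg (fun L : EuclideanSpace ℝ (Fin n) →L[ℝ] Amb n => L w) h2.fderiv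
      simpa only [map_zero, add_zero] using h3
    simpa only [h] using hE
  have hNc : ContinuousAt N (0, t) := by
    have h1 : ContinuousAt (fun q : M × ℝ => ν q.1 q.2) (c 0, t) :=
      hF.normal_continuous.continuousAt (prod_mem_nhds univ_mem (Ico_mem_nhds ht.1 ht.2))
    have h2 : ContinuousAt (fun q : EuclideanSpace ℝ (Fin n) × ℝ => (c q.1, q.2)) (0, t) :=
      (ContinuousAt.comp (g := c) (f := Prod.fst) (x := ((0 : EuclideanSpace ℝ (Fin n)), t))
        (hcs 0 hgood.self_of_nhds).continuousAt continuousAt_fst).prodMk continuousAt_snd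
    exact ContinuousAt.comp (x := ((0 : EuclideanSpace ℝ (Fin n)), t)) h1 h2
  have hN2 : ContDiffAt ℝ 2 N (0, t) :=
    contDiffAt_normal (B := fun i => dirD (coordVec i, (0 : ℝ)) X)
      (fun i => contDiffAt_dirD (k := ∞) _ hX0 (natCast_le_infty 3)) hon hNc hunit
      (horth.mono fun q hq i => hq _)
  have hevol : ∀ᶠ y in 𝓝 (0 : EuclideanSpace ℝ (Fin n)), dirD (0, (1 : ℝ)) X (y, t)
      = -(coordMeanCurvature (fun y => X (y, t)) (N (y, t)) y) • N (y, t) := by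
    -- The evolution equation is differentiated in space, so it is needed at all `y` near `0`; at
    -- each, `c` and `d` must be inverse on a whole neighbourhood.
    filter_upwards [hgood.eventually_nhds] with y hy
    have hy0 := hy.self_of_nhds
    have h1 : HasDerivAt (F (c y)) _ t :=
      (hF.evolution t (Ioo_subset_Ico_self ht) (c y)).hasDerivAt (Ico_mem_nhds ht.1 ht.2)
    have h2 := hasDerivAt_slice ((hXs y hy0 t ht).differentiableAt (by simp))
    have hsrc : c y ∈ φ.source := φ.map_target hy0
    have hH : meanCurvature (fun q => F q t) (ν (c y) t) (c y)
        = coordMeanCurvature ((fun q => F q t) ∘ c) (ν (c y) t) y := by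
      refine meanCurvature_eq_of_param (d := d) (hcs y hy0) ?_ ?_ ?_ (hFt t ht _)
        (horthz y hy0 t ht)
      · have h3 : ContMDiffAt (𝓡 n) 𝓘(ℝ, EuclideanSpace ℝ (Fin n)) ∞ φ (c y) :=
          contMDiffAt_extChartAt' (by simpa [hφ] using hsrc)
        have h4 : ContDiff ℝ ∞ fun v => E.symm (v - φ p) :=
          E.symm.contDiff.comp (contDiff_id.sub contDiff_const)
        exact ContMDiffAt.comp (g := fun v => E.symm (v - φ p)) (c y) h4.contMDiff.contMDiffAt h3
      · filter_upwards [(isOpen_extChartAt_source p).mem_nhds hsrc] with r hr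
        simp [hc, hd, φ.left_inv hr]
      · filter_upwards [hy] with y' hy'
        simp [hc, hd, φ.right_inv hy']
    rw [h2.unique h1, hH]
    rfl
  have hmin' : IsLocalMin (fun y => (inner ℝ (X (y, t)) (N (y, t)) : ℝ)) 0 := by
    have hct : Tendsto c (𝓝 0) (𝓝 p) := by
      simpa only [hc0] using (hcs 0 hgood.self_of_nhds).continuousAt.tendsto
    have h := hct.eventually hmin
    simpa [IsLocalMin, IsMinFilter, hX, hN, hc0] using h
  have h := support_deriv_ge_of_isLocalMin hn (hX0.of_le (natCast_le_infty 3)) hN2 hunit horth hon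
    hevol hmin' (by simpa [hX, hN, hc0] using hpos)
  simpa [hX, hN, hc0] using h

end Manifold

/-! ### The barrier argument -/

section Barrier

variable {n : ℕ} {M : Type*} [TopologicalSpace M] [ChartedSpace (EuclideanSpace ℝ (Fin n)) M]
  {Tc : ℝ} {F ν : M → ℝ → Amb n}

theorem IsMeanCurvatureFlow.continuousOn_position (hF : IsMeanCurvatureFlow Tc F ν) :
    ContinuousOn (fun q : M × ℝ => F q.1 q.2) (univ ×ˢ Ico 0 Tc) :=
  hF.smooth.continuousOn

theorem IsMeanCurvatureFlow.continuousOn_support (hF : IsMeanCurvatureFlow Tc F ν) :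
    ContinuousOn (fun q : M × ℝ => (inner ℝ (F q.1 q.2) (ν q.1 q.2) : ℝ)) (univ ×ˢ Ico 0 Tc) :=
  hF.continuousOn_position.inner hF.normal_continuous

theorem continuous_slice {Y : Type*} [TopologicalSpace Y] {f : M × ℝ → Y} {t : ℝ}
    (hf : ContinuousOn f (univ ×ˢ Ico 0 Tc)) (ht : t ∈ Ico 0 Tc) :
    Continuous fun p => f (p, t) :=
  hf.comp_continuous (by fun_prop) fun p => ⟨mem_univ p, ht⟩

/-- A differentiable function that is larger than `g t` just before `t` has `g' t ≤ 0`. -/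
theorem deriv_nonpos_of_eventually_left {g : ℝ → ℝ} {g' t : ℝ} (hg : HasDerivAt g g' t)
    (h : ∀ᶠ s in 𝓝[<] t, g t ≤ g s) : g' ≤ 0 := by
  have h1 : Tendsto (slope g t) (𝓝[<] t) (𝓝 g') :=
    (hasDerivWithinAt_iff_tendsto_slope' (by simp)).1 hg.hasDerivWithinAt
  refine le_of_tendsto h1 ?_
  filter_upwards [h, self_mem_nhdsWithin] with s hs hst
  rw [slope_def_field]
  exact div_nonpos_of_nonneg_of_nonpos (by linarith) (sub_nonpos.2 (le_of_lt hst))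

/-- The barrier starts at `3 / (4 f₀)`, midway between `1 / (2 f₀)` and `1 / f₀`, and `hT` says that
it loses at most `1 / (4 f₀)` up to time `T`. -/
theorem inv_two_mul_le_barrier {f₀ a t T : ℝ} (hf₀ : 0 < f₀) (ha : 0 ≤ a) (ht : t ≤ T)
    (hT : 16 * a * f₀ ^ 2 * T ≤ 1) : (2 * f₀)⁻¹ ≤ 3 / (4 * f₀) - 4 * a * f₀ * t := by
  have h1 : 16 * a * f₀ ^ 2 * t ≤ 1 := le_trans (by gcongr) hT
  have h2 : 3 / (4 * f₀) - 4 * a * f₀ * t - (2 * f₀)⁻¹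
      = (1 - 16 * a * f₀ ^ 2 * t) / (4 * f₀) := by
    field_simp
    ring
  have h3 : 0 ≤ (1 - 16 * a * f₀ ^ 2 * t) / (4 * f₀) := div_nonneg (by linarith) (by positivity)
  linarith

/-- The support function stays above a linearly decreasing barrier. -/
theorem IsMeanCurvatureFlow.barrier_lt_support [IsManifold (𝓡 n) ∞ M] [CompactSpace M]
    (hF : IsMeanCurvatureFlow Tc F ν) (hn : 1 ≤ n) {f₀ T : ℝ} (hf₀ : 0 < f₀) (hT : T < Tc)
    (hTf : 16 * n * f₀ ^ 2 * T ≤ 1) (h0 : ∀ p, f₀⁻¹ ≤ inner ℝ (F p 0) (ν p 0)) :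
    ∀ t ∈ Icc 0 T, ∀ p, 3 / (4 * f₀) - 4 * n * f₀ * t < inner ℝ (F p t) (ν p t) := by
  by_contra! hcon
  obtain ⟨t₁, ht₁, p₁, hp₁⟩ := hcon
  have hn0 : (0 : ℝ) < n := by exact_mod_cast hn
  set b : ℝ → ℝ := fun t => 3 / (4 * f₀) - 4 * n * f₀ * t with hb
  set u : M → ℝ → ℝ := fun p t => inner ℝ (F p t) (ν p t) with hu
  have hsub : (univ : Set M) ×ˢ Icc 0 T ⊆ univ ×ˢ Ico 0 Tc :=
    prod_mono_right (Icc_subset_Ico_right hT)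
  have hbc : Continuous b := by fun_prop
  have hc : ContinuousOn (fun q : M × ℝ => u q.1 q.2 - b q.2) (univ ×ˢ Ico 0 Tc) :=
    hF.continuousOn_support.sub (hbc.comp continuous_snd).continuousOn
  set S : Set (M × ℝ) := univ ×ˢ Icc 0 T ∩ (fun q : M × ℝ => u q.1 q.2 - b q.2) ⁻¹' Iic 0 with hS
  have hScompact : IsCompact S :=
    (isCompact_univ.prod isCompact_Icc).of_isClosed_subset
      ((hc.mono hsub).preimage_isClosed_of_isClosed (isClosed_univ.prod isClosed_Icc) isClosed_Iic)
      inter_subset_left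
  have hSne : S.Nonempty := ⟨(p₁, t₁), ⟨mem_univ _, ht₁⟩, sub_nonpos.2 hp₁⟩
  -- Minimizing the time coordinate over the compact contact set gives the first contact time.
  obtain ⟨⟨p, t⟩, ⟨⟨-, ht⟩, hpt⟩, hfirst⟩ := hScompact.exists_isMinOn hSne continuousOn_snd
  have hpt' : u p t ≤ b t := sub_nonpos.1 hpt
  have hbefore : ∀ s, 0 ≤ s → s < t → ∀ q, b s < u q s := by
    intro s hs0 hst q
    by_contra! hle
    have : t ≤ s := hfirst
      (show (q, s) ∈ S from ⟨⟨mem_univ _, hs0, hst.le.trans ht.2⟩, sub_nonpos.2 hle⟩)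
    linarith
  have ht0 : 0 < t := by
    rcases ht.1.eq_or_lt with h | h
    · exfalso
      subst h
      have h1 := (h0 p).trans hpt'
      have h2 : b 0 < f₀⁻¹ := by
        simp only [hb, mul_zero, sub_zero]
        rw [div_lt_iff₀ (by positivity)]
        field_simp
        norm_num
      linarith
    · exact h
  have htT : t ∈ Ioo 0 Tc := ⟨ht0, ht.2.trans_lt hT⟩
  have hleft : ∀ᶠ s in 𝓝[<] t, 0 ≤ s ∧ s < t := by
    filter_upwards [mem_nhdsWithin_of_mem_nhds (Ioi_mem_nhds ht0), self_mem_nhdsWithin]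
      with s h1 h2
    exact ⟨le_of_lt h1, h2⟩
  -- The limit from earlier times shows that `p` is a global spatial minimum of `u` at time `t`.
  have hall : ∀ q, b t ≤ u q t := by
    intro q
    have h1 : ContinuousAt (fun q : M × ℝ => u q.1 q.2 - b q.2) (q, t) :=
      hc.continuousAt (prod_mem_nhds univ_mem (Ico_mem_nhds htT.1 htT.2))
    have h2 : Tendsto (fun s => u q s - b s) (𝓝[<] t) (𝓝 (u q t - b t)) :=
      (ContinuousAt.comp (f := fun s : ℝ => (q, s)) (x := t) h1
        (by fun_prop)).tendsto.mono_left nhdsWithin_le_nhds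
    refine sub_nonneg.1 (ge_of_tendsto h2 ?_)
    filter_upwards [hleft] with s hs
    exact (sub_pos.2 (hbefore s hs.1 hs.2 q)).le
  have heq : u p t = b t := le_antisymm hpt' (hall p)
  have hbt : (2 * f₀)⁻¹ ≤ b t := inv_two_mul_le_barrier hf₀ hn0.le ht.2 hTf
  have hupos : 0 < u p t := by
    rw [heq]
    exact lt_of_lt_of_le (by positivity) hbt
  obtain ⟨u', hu', hge⟩ := hF.support_deriv_ge hn htT (p := p)
    (Eventually.of_forall fun q => (hpt'.trans (hall q) : u p t ≤ u q t)) hupos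
  have hbd : HasDerivAt b (-(4 * n * f₀)) t := by
    simpa using ((hasDerivAt_id t).const_mul (4 * n * f₀)).const_sub (3 / (4 * f₀))
  have hle := deriv_nonpos_of_eventually_left (hu'.sub hbd) (by
    filter_upwards [hleft] with s hs
    have h1 := hbefore s hs.1 hs.2 p
    change u p t - b t ≤ u p s - b s
    linarith)
  -- Contact forces `u' ≤ -4 n f₀`, whereas the minimum principle gives `u' ≥ -2 n f₀`.
  have hdiv : n / u p t ≤ 2 * n * f₀ := by
    rw [heq, div_le_iff₀ (lt_of_lt_of_le (by positivity) hbt)]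
    calc (n : ℝ) = 2 * n * f₀ * (2 * f₀)⁻¹ := by field_simp
      _ ≤ 2 * n * f₀ * b t := by gcongr
  have hge' : -(n / u p t) ≤ u' := hge
  have : 0 < n * f₀ := by positivity
  linarith

end Barrier

end StarMCF

end

/-! ### Choice of the constants -/

theorem theorem1 (n : ℕ) (hn : 1 ≤ n) (M₀ : Set (StarMCF.Amb n)) :
    ∃ c₃ : ℝ, 0 < c₃ ∧ ∀ T₀ : ℝ, 0 < T₀ → ∃ G : ℝ, 0 < G ∧
      ∀ (M : Type*) [TopologicalSpace M] [T2Space M] [CompactSpace M] [Nonempty M]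
        [ChartedSpace (EuclideanSpace ℝ (Fin n)) M] [IsManifold (𝓡 n) ∞ M]
        (Tc : ℝ) (F ν : M → ℝ → StarMCF.Amb n),
        StarMCF.IsMeanCurvatureFlow Tc F ν →
        Set.range (fun p => F p 0) = M₀ →
        StarMCF.IsStarShaped (fun p => F p 0) (fun p => ν p 0) →
        T₀ < Tc →
        ∃ f₀ : ℝ, IsGreatest (Set.range fun p : M => (inner ℝ (F p 0) (ν p 0))⁻¹) f₀ ∧
          0 < min (1 / (G * f₀ ^ 4)) T₀ ∧ min (1 / (G * f₀ ^ 4)) T₀ ≤ T₀ ∧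
          ∀ t ∈ Set.Icc 0 (min (1 / (G * f₀ ^ 4)) T₀), ∀ p : M,
            0 < inner ℝ (F p t) (ν p t) ∧ (inner ℝ (F p t) (ν p t))⁻¹ ≤ 2 * c₃ * f₀ := by
  have hn0 : (0 : ℝ) < n := by exact_mod_cast hn
  obtain ⟨R, hR⟩ : ∃ R : ℝ, Bornology.IsBounded M₀ → ∀ x ∈ M₀, ‖x‖ ≤ R := by
    by_cases hb : Bornology.IsBounded M₀
    · obtain ⟨R, hR⟩ := hb.exists_norm_le
      exact ⟨R, fun _ => hR⟩
    · exact ⟨0, fun h => absurd h hb⟩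
  -- The barrier already gives the bound with `c₃ = 1`. The `+ 1` keeps `G` positive even when `R =
  -- 0`.
  refine ⟨1, one_pos, fun T₀ hT₀ => ⟨16 * n * (R ^ 2 + 1), by positivity, ?_⟩⟩
  intro M _ _ _ _ _ _ Tc F ν hF hM₀ hstar hTc
  have h0Tc : (0 : ℝ) ∈ Ico 0 Tc := ⟨le_rfl, hT₀.trans hTc⟩
  have hFc : Continuous fun p => F p 0 :=
    StarMCF.continuous_slice hF.continuousOn_position h0Tc
  have huc : Continuous fun p => (inner ℝ (F p 0) (ν p 0) : ℝ) :=
    StarMCF.continuous_slice hF.continuousOn_support h0Tc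
  have hpos : ∀ p, 0 < inner ℝ (F p 0) (ν p 0) := hstar
  have hbound : ∀ p, ‖F p 0‖ ≤ R := fun p =>
    hR (hM₀ ▸ (isCompact_range hFc).isBounded) _ (hM₀ ▸ mem_range_self p)
  obtain ⟨f₀, hf₀⟩ := (isCompact_range (huc.inv₀ fun p => (hpos p).ne')).exists_isGreatest
    (range_nonempty _)
  refine ⟨f₀, hf₀, ?_⟩
  have hf₀ge : ∀ p, (inner ℝ (F p 0) (ν p 0))⁻¹ ≤ f₀ := fun p => hf₀.2 (mem_range_self p)
  obtain ⟨p₀, hp₀⟩ := hf₀.1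
  have hf₀pos : 0 < f₀ := hp₀ ▸ inv_pos.2 (hpos p₀)
  -- By Cauchy–Schwarz `1 / f₀ = u ≤ R` at `p₀`. This pays for the two extra powers of `f₀` in `G
  -- f₀⁴`.
  have hRf : 1 ≤ (R ^ 2 + 1) * f₀ ^ 2 := by
    have h1 : inner ℝ (F p₀ 0) (ν p₀ 0) ≤ R := by
      refine (real_inner_le_norm _ _).trans ?_
      rw [hF.normal_unit 0 h0Tc, mul_one]
      exact hbound p₀
    have h2 : 1 ≤ R * f₀ := by
      rw [← hp₀]
      change 1 ≤ R * (inner ℝ (F p₀ 0) (ν p₀ 0))⁻¹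
      rw [← div_eq_mul_inv, one_le_div (hpos p₀)]
      exact h1
    nlinarith
  have hG : 0 < 16 * n * (R ^ 2 + 1) * f₀ ^ 4 := by positivity
  set T := min (1 / (16 * n * (R ^ 2 + 1) * f₀ ^ 4)) T₀ with hT
  have hTpos : 0 < T := lt_min (by positivity) hT₀
  have hTf : 16 * n * f₀ ^ 2 * T ≤ 1 := by
    have h1 : 16 * n * (R ^ 2 + 1) * f₀ ^ 4 * T ≤ 1 := by
      rw [mul_comm, ← le_div_iff₀ hG]
      exact min_le_left _ _
    refine le_trans ?_ h1
    calc 16 * n * f₀ ^ 2 * T = 16 * n * f₀ ^ 2 * T * 1 := by ring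
      _ ≤ 16 * n * f₀ ^ 2 * T * ((R ^ 2 + 1) * f₀ ^ 2) := by gcongr
      _ = _ := by ring
  refine ⟨hTpos, min_le_right _ _, fun t ht p => ?_⟩
  have hlt := hF.barrier_lt_support hn hf₀pos ((min_le_right _ _).trans_lt hTc) hTf
    (fun p => inv_le_of_inv_le₀ (hpos p) (hf₀ge p)) t ht p
  have hlow : (2 * f₀)⁻¹ ≤ inner ℝ (F p t) (ν p t) :=
    (StarMCF.inv_two_mul_le_barrier hf₀pos hn0.le ht.2 hTf).trans hlt.le
  have hlowpos : 0 < (2 * f₀)⁻¹ := by positivity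
  refine ⟨hlowpos.trans_le hlow, ?_⟩
  rw [mul_one]
  exact inv_le_of_inv_le₀ (by positivity) hlow
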